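/- Let $F_2^n$ be the set of binary vectors of length $n$, let $d(x,y)$ be the Hamming distance, and put $\langle x,y\rangle = 1-2d(x,y)/n$. Let $Q_0^{(n)},\dots,Q_n^{(n)}$ be the normalized Krawtchouk polynomials, defined by $Q_0^{(n)}(t)=1$, $Q_1^{(n)}(t)=t$ and $n\,t\,Q_i^{(n)}(t)=(n-i)Q_{i+1}^{(n)}(t)+i\,Q_{i-1}^{(n)}(t)$ for $1\le i\le n-1$. For a non-empty set $C\subseteq F_2^n$ let $M_i(C)=\sum_{x,y\in C}Q_i^{(n)}(\langle x,y\rangle)$, $1\le i\le n$. For $1\le m\le n$, $C$ is an $m$-design if $M_i(C)=0$ for all $i=1,2,\dots,m$; for $1\le k\le n/2$, $C$ is a $(k,k)$-design if $M_i(C)=0$ for all $i=2,4,\dots,2k$. A $(k,k)$-design $C\subseteq F_2^n$ is tight if $|C|=\sum_{i=0}^{k}\binom{n-1}{i}$, and a $(2k+1)$-design $D\subseteq F_2^n$ is tight if it attains the Rao bound, i.e. $|D|=2\sum_{i=0}^{k}\binom{n-1}{i}$. Theorem. Let $n$ and $k$ be integers with $k\ge 1$ and $2k+1\le n$. Then a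 tight $(k,k)$-design exists in $F_2^n$ if and only if a tight $(2k+1)$-design exists in $F_2^n$. -/

import Mathlib

/-- The normalized binary Krawtchouk polynomials `Q_i^{(n)}(t)`, as real polynomial functions, given by
`Q_0 = 1`, `Q_1 = t` and `n t Q_i = (n - i) Q_{i+1} + i Q_{i-1}` for `1 ≤ i ≤ n - 1`.
They are meaningful for `i ≤ n`. -/
noncomputable def krawtchoukQ (n : ℕ) : ℕ → ℝ → ℝ
  | 0, _ => 1
  | 1, t => t
  | (i + 2), t =>
      ((n : ℝ) * t * krawtchoukQ n (i + 1) t - ((i : ℝ) + 1) * krawtchoukQ n i t) /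
        ((n : ℝ) - ((i : ℝ) + 1))

/-- The "inner product" `⟨x, y⟩ = 1 - 2 d(x, y) / n` on `F_2^n`, where `d` is the Hamming distance. -/
noncomputable def codeInner {n : ℕ} (x y : Fin n → ZMod 2) : ℝ :=
  1 - 2 * (hammingDist x y : ℝ) / (n : ℝ)

/-- The `i`-th moment `M_i(C) = ∑_{x, y ∈ C} Q_i^{(n)}(⟨x, y⟩)` of `C ⊆ F_2^n`. -/
noncomputable def codeMoment {n : ℕ} (C : Finset (Fin n → ZMod 2)) (i : ℕ) : ℝ :=
  ∑ x ∈ C, ∑ y ∈ C, krawtchoukQ n i (codeInner x y)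

/-- `C ⊆ F_2^n` is a `T`-design, `T ⊆ {1, …, n}`: it is a code (a non-empty set) and
`M_i(C) = 0` for all `i ∈ T`. -/
def IsTDesign {n : ℕ} (T : Finset ℕ) (C : Finset (Fin n → ZMod 2)) : Prop :=
  T ⊆ Finset.Icc 1 n ∧ C.Nonempty ∧ ∀ i ∈ T, codeMoment C i = 0

/-- An `m`-design (binary orthogonal array of strength `m`): a `{1, 2, …, m}`-design. -/
def IsMDesign {n : ℕ} (m : ℕ) (C : Finset (Fin n → ZMod 2)) : Prop :=
  IsTDesign (Finset.Icc 1 m) C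

/-- A `(k,k)`-design: a `{2, 4, …, 2k}`-design. -/
def IsKKDesign {n : ℕ} (k : ℕ) (C : Finset (Fin n → ZMod 2)) : Prop :=
  IsTDesign ((Finset.Icc 1 k).image (fun j => 2 * j)) C

/-- A tight `(k,k)`-design in `F_2^n`: one with exactly `∑_{i=0}^k C(n-1, i)` points. -/
def IsTightKKDesign {n : ℕ} (k : ℕ) (C : Finset (Fin n → ZMod 2)) : Prop :=
  IsKKDesign k C ∧ C.card = ∑ i ∈ Finset.range (k + 1), (n - 1).choose i

/-- A tight `(2k+1)`-design in `F_2^n`: one that attains the Rao bound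
`2 ∑_{i=0}^k C(n-1, i)` for `(2k+1)`-designs. -/
def IsTightOddDesign {n : ℕ} (k : ℕ) (C : Finset (Fin n → ZMod 2)) : Prop :=
  IsMDesign (2 * k + 1) C ∧ C.card = 2 * ∑ i ∈ Finset.range (k + 1), (n - 1).choose i

/-! Up to the factor `n.choose i`, the moment `M_i(C)` is the sum of the squared character sums of
`C` over coordinate sets of size `i`, so being a design means that these sums vanish
(`codeMoment_eq_zero_iff`). For a tight `(k,k)`-design the characters in `evenSets a k`, restricted
to `C`, form a square matrix with orthogonal rows, hence orthogonal columns. Even characters agree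
at `x` and `x + 1`, so `C` has no antipodal pair. Adjoining antipodes then doubles `C` and cancels
all odd character sums. Conversely, fixing a coordinate `a` halves a tight `(2k+1)`-design and mixes
the sums of `u` and `symmDiff u {a}`, both zero for even nonempty `u` of size at most `2k`. -/

/-! ### Krawtchouk polynomials as elementary symmetric functions of signs -/

open Finset Polynomial in
/-- A product of linear factors `1 + s_j X` with signs `s_j = ±1` satisfies a first-order
differential equation. -/
theorem one_sub_sq_mul_derivative_prod {ι : Type*} [DecidableEq ι] (s : ι → ℝ)
    (hs : ∀ j, s j * s j = 1) (A : Finset ι) :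
    (1 - X ^ 2) * derivative (∏ j ∈ A, (1 + C (s j) * X)) =
      (C (∑ j ∈ A, s j) - C (#A : ℝ) * X) * ∏ j ∈ A, (1 + C (s j) * X) := by
  induction A using Finset.induction_on with
  | empty => simp
  | insert a A ha ih =>
    have hC : C (s a) * C (s a) = (1 : ℝ[X]) := by rw [← C_mul, hs, C_1]
    rw [prod_insert ha, sum_insert ha, card_insert_of_notMem ha, derivative_mul]
    have hd : derivative (1 + C (s a) * X) = C (s a) := by simp
    rw [hd]
    push_cast
    simp only [C_add, C_1] at ih ⊢
    linear_combination (1 + C (s a) * X) * ih + (-X * ∏ j ∈ A, (1 + C (s j) * X)) * hC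

open Finset Polynomial in
theorem coeff_prod_one_add_C_mul_X {ι : Type*} [DecidableEq ι] (s : ι → ℝ) (A : Finset ι) (i : ℕ) :
    (∏ j ∈ A, (1 + C (s j) * X)).coeff i = ∑ u ∈ A.powersetCard i, ∏ j ∈ u, s j := by
  rw [prod_one_add, finsetSum_coeff, powersetCard_eq_filter, sum_filter]
  refine sum_congr rfl fun u _ => ?_
  rw [prod_mul_distrib, prod_const, ← map_prod, coeff_C_mul, coeff_X_pow]
  by_cases h : #u = i
  · simp [h]
  · simp [h, Ne.symm h]

open Finset Polynomial in
/-- Three-term recurrence for elementary symmetric functions of signs. -/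
theorem sum_mul_esymm_of_sign {ι : Type*} [DecidableEq ι] (s : ι → ℝ)
    (hs : ∀ j, s j * s j = 1) (A : Finset ι) (i : ℕ) :
    (∑ j ∈ A, s j) * ∑ u ∈ A.powersetCard (i + 1), ∏ j ∈ u, s j =
      (i + 2) * (∑ u ∈ A.powersetCard (i + 2), ∏ j ∈ u, s j) +
        (#A - i) * ∑ u ∈ A.powersetCard i, ∏ j ∈ u, s j := by
  have h := congrArg (fun p => p.coeff (i + 1)) (one_sub_sq_mul_derivative_prod s hs A)
  simp only [sub_mul, one_mul, coeff_sub, mul_assoc, coeff_C_mul, coeff_X_mul,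
    coeff_prod_one_add_C_mul_X, coeff_derivative] at h
  have h2 : (X ^ 2 * derivative (∏ j ∈ A, (1 + C (s j) * X))).coeff (i + 1) =
      i * ∑ u ∈ A.powersetCard i, ∏ j ∈ u, s j := by
    cases i with
    | zero => simp [coeff_X_pow_mul']
    | succ i =>
      rw [show i + 1 + 1 = i + 2 from rfl, coeff_X_pow_mul, coeff_derivative,
        coeff_prod_one_add_C_mul_X]
      push_cast
      ring
  rw [h2] at h
  push_cast at h
  linear_combination -h

-- After scaling by `n.choose i`, the Krawtchouk recurrence becomes that of `sum_mul_esymm_of_sign`.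
open Finset in
theorem choose_mul_krawtchoukQ_eq_esymm {n : ℕ} (s : Fin n → ℝ) (hs : ∀ j, s j * s j = 1) (t : ℝ)
    (ht : (n : ℝ) * t = ∑ j, s j) (i : ℕ) (hi : i ≤ n) :
    (n.choose i : ℝ) * krawtchoukQ n i t = ∑ u ∈ univ.powersetCard i, ∏ j ∈ u, s j := by
  induction i using Nat.strong_induction_on with
  | _ i ih =>
    match i with
    | 0 => simp [krawtchoukQ]
    | 1 => simp [krawtchoukQ, ht, powersetCard_one]
    | i + 2 =>
      have h1 := ih (i + 1) (by omega) (by omega)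
      have h0 := ih i (by omega) (by omega)
      have h := sum_mul_esymm_of_sign s hs univ i
      rw [← h1, ← h0, ← ht, card_univ, Fintype.card_fin] at h
      have c1 : (n.choose (i + 2) : ℝ) * (i + 2) = n.choose (i + 1) * (n - (i + 1)) := by
        have := Nat.choose_succ_right_eq n (i + 1)
        have h3 : ((n - (i + 1) : ℕ) : ℝ) = n - (i + 1) := by
          rw [Nat.cast_sub (by omega)]; push_cast; ring
        rw [← h3]
        exact_mod_cast this
      have c0 : (n.choose (i + 1) : ℝ) * (i + 1) = n.choose i * (n - i) := by
        have := Nat.choose_succ_right_eq n i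
        have h3 : ((n - i : ℕ) : ℝ) = n - i := by
          rw [Nat.cast_sub (by omega)]
        rw [← h3]
        exact_mod_cast this
      -- The recursion divides by this; it is nonzero because `i + 2 ≤ n`.
      have hne : (n : ℝ) - (i + 1) ≠ 0 := by
        have : ((i + 2 : ℕ) : ℝ) ≤ n := by exact_mod_cast hi
        push_cast at this
        linarith
      have hi2 : (i + 2 : ℝ) ≠ 0 := by positivity
      have hQ : krawtchoukQ n (i + 2) t * ((n : ℝ) - (i + 1)) =
          n * t * krawtchoukQ n (i + 1) t - (i + 1) * krawtchoukQ n i t := by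
        rw [krawtchoukQ]
        exact div_mul_cancel₀ _ hne
      apply mul_left_cancel₀ hi2
      linear_combination krawtchoukQ n (i + 2) t * c1 + n.choose (i + 1) * hQ + h -
        krawtchoukQ n i t * c0

/-! ### Characters and moments -/

/-- The nontrivial real character of `ZMod 2`. -/
noncomputable def binarySign (a : ZMod 2) : ℝ := if a = 0 then 1 else -1

theorem binarySign_mul_self (a : ZMod 2) : binarySign a * binarySign a = 1 := by
  unfold binarySign
  split <;> norm_num

theorem binarySign_mul (a b : ZMod 2) :
    binarySign a * binarySign b = if a = b then 1 else -1 := by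
  have h : ∀ c : ZMod 2, c = 0 ∨ c = 1 := by decide
  rcases h a with rfl | rfl <;> rcases h b with rfl | rfl <;> simp [binarySign]

theorem binarySign_add_one (a : ZMod 2) : binarySign (a + 1) = -binarySign a := by
  have h : ∀ c : ZMod 2, c = 0 ∨ c = 1 := by decide
  rcases h a with rfl | rfl
  · simp [binarySign]
  · simp [binarySign, show (1 : ZMod 2) + 1 = 0 from rfl]

/-- The character `x ↦ (-1)^{⟨1_u, x⟩}` of `F_2^n` attached to a set of coordinates. -/
noncomputable def walsh {n : ℕ} (u : Finset (Fin n)) (x : Fin n → ZMod 2) : ℝ :=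
  ∏ j ∈ u, binarySign (x j)

open Finset in
theorem walsh_mul {n : ℕ} (u v : Finset (Fin n)) (x : Fin n → ZMod 2) :
    walsh u x * walsh v x = walsh (symmDiff u v) x := by
  have hsq : (∏ j ∈ u ∩ v, binarySign (x j)) * ∏ j ∈ u ∩ v, binarySign (x j) = 1 := by
    rw [← prod_mul_distrib]
    exact prod_eq_one fun j _ => binarySign_mul_self _
  unfold walsh
  rw [Finset.symmDiff_def, prod_union disjoint_sdiff_sdiff,
    ← prod_inter_mul_prod_sdiff u v, ← prod_inter_mul_prod_sdiff v u, inter_comm v u]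
  linear_combination ((∏ j ∈ u \ v, binarySign (x j)) * ∏ j ∈ v \ u, binarySign (x j)) * hsq

theorem walsh_mul_self {n : ℕ} (u : Finset (Fin n)) (x : Fin n → ZMod 2) :
    walsh u x * walsh u x = 1 := by
  rw [walsh_mul, symmDiff_self]
  simp [walsh]

theorem walsh_add_one {n : ℕ} (u : Finset (Fin n)) (x : Fin n → ZMod 2) :
    walsh u (x + 1) = (-1) ^ u.card * walsh u x := by
  simp only [walsh, Pi.add_apply, Pi.one_apply, binarySign_add_one]
  rw [Finset.prod_neg]

open Finset in
theorem mul_codeInner {n : ℕ} (hn : n ≠ 0) (x y : Fin n → ZMod 2) :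
    (n : ℝ) * codeInner x y = ∑ j, binarySign (x j) * binarySign (y j) := by
  have hn' : (n : ℝ) ≠ 0 := by exact_mod_cast hn
  have h : ∀ j, binarySign (x j) * binarySign (y j) = 1 - 2 * (if x j ≠ y j then 1 else 0) := by
    intro j
    rw [binarySign_mul]
    by_cases h : x j = y j
    · simp [h]
    · simp [h]; norm_num
  simp only [h, sum_sub_distrib, ← mul_sum, sum_boole]
  simp only [codeInner, hammingDist, sum_const, card_univ, Fintype.card_fin, nsmul_eq_mul, mul_one]
  field_simp

-- The signs of `x + y` turn the elementary symmetric function into a sum of `walsh u x * walsh u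
-- y`; summing over pairs gives squares.
open Finset in
theorem choose_mul_codeMoment {n : ℕ} (hn : n ≠ 0) (C : Finset (Fin n → ZMod 2)) (i : ℕ)
    (hi : i ≤ n) :
    (n.choose i : ℝ) * codeMoment C i = ∑ u ∈ univ.powersetCard i, (∑ x ∈ C, walsh u x) ^ 2 := by
  have h : ∀ x y : Fin n → ZMod 2, (n.choose i : ℝ) * krawtchoukQ n i (codeInner x y) =
      ∑ u ∈ univ.powersetCard i, walsh u x * walsh u y := by
    intro x y
    rw [choose_mul_krawtchoukQ_eq_esymm (fun j => binarySign (x j) * binarySign (y j)) _ _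
      (mul_codeInner hn x y) i hi]
    · simp only [prod_mul_distrib, walsh]
    · intro j
      linear_combination binarySign (y j) * binarySign (y j) * binarySign_mul_self (x j) +
        binarySign_mul_self (y j)
  simp only [codeMoment, mul_sum, h]
  simp only [pow_two, sum_mul_sum]
  rw [sum_comm (s := univ.powersetCard i)]
  exact sum_congr rfl fun x _ => sum_comm

open Finset in
theorem codeMoment_eq_zero_iff {n : ℕ} (hn : n ≠ 0) (C : Finset (Fin n → ZMod 2)) (i : ℕ)
    (hi : i ≤ n) :
    codeMoment C i = 0 ↔ ∀ u : Finset (Fin n), #u = i → ∑ x ∈ C, walsh u x = 0 := by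
  have hc : (n.choose i : ℝ) ≠ 0 := by exact_mod_cast (Nat.choose_pos hi).ne'
  rw [← mul_right_inj' hc, mul_zero, choose_mul_codeMoment hn C i hi,
    sum_eq_zero_iff_of_nonneg fun _ _ => sq_nonneg _]
  simp [mem_powersetCard]

/-! ### A square system of even characters -/

open Finset in
/-- Even sets of coordinates with at most `k` elements different from `a`. -/
def evenSets {n : ℕ} (a : Fin n) (k : ℕ) : Finset (Finset (Fin n)) :=
  univ.filter fun w => Even #w ∧ #(w.erase a) ≤ k

-- Parity decides whether `a ∈ w`, so `w` is recovered from `w.erase a`.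
open Finset in
theorem card_evenSets {n : ℕ} (a : Fin n) (k : ℕ) :
    #(evenSets a k) = ∑ i ∈ range (k + 1), (n - 1).choose i := by
  have h1 : #(evenSets a k) = #((univ.erase a).powerset.filter fun w => #w ≤ k) := by
    refine card_bij' (fun w _ => w.erase a) (fun w _ => if Even #w then w else insert a w)
      ?_ ?_ ?_ ?_
    · intro w hw
      simp only [evenSets, mem_filter, mem_univ, true_and] at hw
      simp only [mem_filter, mem_powerset]
      exact ⟨erase_subset_erase _ (subset_univ _), hw.2⟩
    · intro w hw
      simp only [mem_filter, mem_powerset] at hw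
      have ha : a ∉ w := fun h => by simpa using hw.1 h
      simp only [evenSets, mem_filter, mem_univ, true_and]
      split_ifs with he
      · exact ⟨he, by rw [erase_eq_of_notMem ha]; exact hw.2⟩
      · rw [card_insert_of_notMem ha, erase_insert ha]
        exact ⟨by rw [Nat.even_add_one]; exact he, hw.2⟩
    · intro w hw
      simp only [evenSets, mem_filter, mem_univ, true_and] at hw
      by_cases ha : a ∈ w
      · have hc := card_erase_add_one ha
        have he : ¬ Even #(w.erase a) := by
          rw [← Nat.even_add_one, hc]; exact hw.1
        simp only [he, if_false, insert_erase ha]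
      · simp only [erase_eq_of_notMem ha, hw.1, if_true]
    · intro w hw
      simp only [mem_filter, mem_powerset] at hw
      have ha : a ∉ w := fun h => by simpa using hw.1 h
      split_ifs with he
      · exact erase_eq_of_notMem ha
      · exact erase_insert ha
  rw [h1, card_eq_sum_card_fiberwise (f := card) (t := range (k + 1))]
  · refine sum_congr rfl fun i hi => ?_
    have : (univ.erase a).card = n - 1 := by simp
    rw [← this, ← card_powersetCard]
    congr 1
    ext w
    simp only [mem_filter, mem_powerset, mem_powersetCard]
    simp only [mem_range] at hi
    constructor
    · rintro ⟨⟨h, _⟩, h'⟩; exact ⟨h, h'⟩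
    · rintro ⟨h, h'⟩; exact ⟨⟨h, by omega⟩, h'⟩
  · intro w hw
    simp only [coe_filter, Set.mem_ofPred_eq] at hw
    simp only [coe_range, Set.mem_Iio]
    omega

open Finset in
theorem card_symmDiff_add {α : Type*} [DecidableEq α] (u v : Finset α) :
    #(symmDiff u v) + 2 * #(u ∩ v) = #u + #v := by
  rw [Finset.symmDiff_def, card_union_of_disjoint disjoint_sdiff_sdiff]
  have h1 := card_sdiff_add_card_inter u v
  have h2 := card_sdiff_add_card_inter v u
  rw [inter_comm v u] at h2
  omega

-- Away from `a` there are at most `2 * k` elements; `a` could add one more, but `2 * k + 1` is odd.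
open Finset in
theorem symmDiff_evenSets {n k : ℕ} {a : Fin n} {u v : Finset (Fin n)} (hu : u ∈ evenSets a k)
    (hv : v ∈ evenSets a k) : Even #(symmDiff u v) ∧ #(symmDiff u v) ≤ 2 * k := by
  simp only [evenSets, mem_filter, mem_univ, true_and] at hu hv
  have he : Even #(symmDiff u v) := by
    have := card_symmDiff_add u v
    obtain ⟨⟨p, hp⟩, -⟩ := hu
    obtain ⟨⟨q, hq⟩, -⟩ := hv
    exact ⟨p + q - #(u ∩ v), by omega⟩
  refine ⟨he, ?_⟩
  have hsub : (symmDiff u v).erase a ⊆ u.erase a ∪ v.erase a := by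
    intro j hj
    simp only [mem_erase, mem_symmDiff, mem_union] at hj ⊢
    tauto
  have h1 := (card_le_card hsub).trans (card_union_le _ _)
  have h2 := pred_card_le_card_erase (s := symmDiff u v) (a := a)
  obtain ⟨p, hp⟩ := he
  omega

open Finset Matrix in
/-- A square system of mutually orthogonal characters has orthogonal columns. -/
theorem sum_walsh_mul_walsh_eq_zero {n : ℕ} {C : Finset (Fin n → ZMod 2)}
    {F : Finset (Finset (Fin n))} (hcard : #F = #C)
    (horth : ∀ u ∈ F, ∀ v ∈ F, u ≠ v → ∑ x ∈ C, walsh (symmDiff u v) x = 0)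
    {x y : Fin n → ZMod 2} (hx : x ∈ C) (hy : y ∈ C) (hxy : x ≠ y) :
    ∑ u ∈ F, walsh u x * walsh u y = 0 := by
  have hC : (#C : ℝ) ≠ 0 := by
    exact_mod_cast (card_pos.2 ⟨x, hx⟩).ne'
  let H : Matrix F C ℝ := Matrix.of fun u x => walsh u.1 x.1
  have h1 : H * ((#C : ℝ)⁻¹ • Hᵀ) = 1 := by
    ext u v
    rw [Matrix.mul_smul, Matrix.smul_apply, Matrix.mul_apply]
    simp only [H, transpose_apply, of_apply, walsh_mul]
    rw [sum_coe_sort C fun x => walsh (symmDiff u.1 v.1) x]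
    by_cases huv : u = v
    · subst huv
      simp [walsh, hC]
    · rw [horth u.1 u.2 v.1 v.2 fun h => huv (Subtype.ext h), one_apply_ne huv, smul_zero]
  -- Squareness turns the right inverse into a left inverse: row orthogonality becomes column
  -- orthogonality.
  have h2 := (mul_eq_one_comm_of_card_eq _ _ _ (by simpa using hcard)).1 h1
  have h3 := congrFun (congrFun h2 ⟨x, hx⟩) ⟨y, hy⟩
  rw [one_apply_ne (by simpa using hxy), Matrix.smul_mul, Matrix.smul_apply, Matrix.mul_apply,
    smul_eq_mul, mul_eq_zero] at h3
  have h4 := h3.resolve_left (inv_ne_zero hC)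
  simp only [H, transpose_apply, of_apply] at h4
  rwa [sum_coe_sort F fun u => walsh u x * walsh u y] at h4

/-! ### Designs via character sums, and the two constructions -/

open Finset in
theorem isKKDesign_iff {n k : ℕ} (hk : 1 ≤ k) (hn : 2 * k ≤ n) (C : Finset (Fin n → ZMod 2)) :
    IsKKDesign k C ↔ C.Nonempty ∧ ∀ u : Finset (Fin n), u.Nonempty → Even #u → #u ≤ 2 * k →
      ∑ x ∈ C, walsh u x = 0 := by
  have hn0 : n ≠ 0 := by omega
  constructor
  · rintro ⟨-, hC, h⟩
    refine ⟨hC, fun u hu ⟨j, hj⟩ huk => ?_⟩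
    have := hu.card_pos
    refine (codeMoment_eq_zero_iff hn0 C #u (by omega)).1 (h _ ?_) u rfl
    exact mem_image.2 ⟨j, mem_Icc.2 (by omega), by omega⟩
  · rintro ⟨hC, h⟩
    refine ⟨fun i hi => ?_, hC, fun i hi => ?_⟩ <;>
      obtain ⟨j, hj, rfl⟩ := mem_image.1 hi <;> rw [mem_Icc] at hj
    · exact mem_Icc.2 (by omega)
    · refine (codeMoment_eq_zero_iff hn0 C _ (by omega)).2 fun u hu => ?_
      exact h u (card_pos.1 (by omega)) ⟨j, by omega⟩ (by omega)

open Finset in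
theorem isMDesign_iff {n m : ℕ} (hn0 : n ≠ 0) (hn : m ≤ n) (C : Finset (Fin n → ZMod 2)) :
    IsMDesign m C ↔ C.Nonempty ∧ ∀ u : Finset (Fin n), u.Nonempty → #u ≤ m →
      ∑ x ∈ C, walsh u x = 0 := by
  constructor
  · rintro ⟨-, hC, h⟩
    refine ⟨hC, fun u hu huk => ?_⟩
    exact (codeMoment_eq_zero_iff hn0 C #u (by omega)).1
      (h _ (mem_Icc.2 ⟨hu.card_pos, huk⟩)) u rfl
  · rintro ⟨hC, h⟩
    refine ⟨Icc_subset_Icc_right hn, hC, fun i hi => ?_⟩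
    rw [mem_Icc] at hi
    refine (codeMoment_eq_zero_iff hn0 C _ (by omega)).2 fun u hu => ?_
    exact h u (card_pos.1 (by omega)) (by omega)

open Finset in
/-- A tight `(k,k)`-design contains no pair of antipodal points. -/
theorem IsTightKKDesign.add_one_notMem {n k : ℕ} (hk : 1 ≤ k) (hn : 2 * k ≤ n)
    {C : Finset (Fin n → ZMod 2)} (hC : IsTightKKDesign k C) {x : Fin n → ZMod 2} (hx : x ∈ C) :
    x + 1 ∉ C := by
  intro hx'
  obtain ⟨hd, hcard⟩ := hC
  rw [isKKDesign_iff hk hn] at hd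
  let a : Fin n := ⟨0, by omega⟩
  have hF : #(evenSets a k) = #C := by rw [card_evenSets, hcard]
  have hne : x ≠ x + 1 := fun h => by
    have := congrFun h a
    simp at this
  have h := sum_walsh_mul_walsh_eq_zero hF (fun u hu v hv huv => by
    obtain ⟨he, hle⟩ := symmDiff_evenSets hu hv
    refine hd.2 _ ?_ he hle
    rw [nonempty_iff_ne_empty, ← bot_eq_empty, Ne, symmDiff_eq_bot]
    exact huv) hx hx' hne
  have h1 : ∀ u ∈ evenSets a k, walsh u x * walsh u (x + 1) = 1 := by
    intro u hu
    simp only [evenSets, mem_filter, mem_univ, true_and] at hu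
    rw [walsh_add_one, hu.1.neg_one_pow, one_mul, walsh_mul_self]
  rw [sum_congr rfl h1, sum_const, nsmul_eq_mul, mul_one, Nat.cast_eq_zero, hF,
    card_eq_zero] at h
  exact hd.1.ne_empty h

open Finset in
/-- Adjoining all antipodes to a tight `(k,k)`-design gives a tight `(2k+1)`-design. -/
theorem IsTightKKDesign.union_antipodes {n k : ℕ} (hk : 1 ≤ k) (hn : 2 * k + 1 ≤ n)
    {C : Finset (Fin n → ZMod 2)} (hC : IsTightKKDesign k C) :
    IsTightOddDesign k (C ∪ C.image (· + 1)) := by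
  have hdisj : Disjoint C (C.image (· + 1)) := by
    rw [disjoint_right]
    intro y hy
    obtain ⟨x, hx, rfl⟩ := mem_image.1 hy
    exact hC.add_one_notMem hk (by omega) hx
  have hinj : Function.Injective fun x : Fin n → ZMod 2 => x + 1 := add_left_injective 1
  obtain ⟨hd, hcard⟩ := hC
  rw [isKKDesign_iff hk (by omega)] at hd
  refine ⟨(isMDesign_iff (by omega) hn _).2 ⟨hd.1.mono subset_union_left, fun u hu hle => ?_⟩, ?_⟩
  · rw [sum_union hdisj, sum_image hinj.injOn]
    simp only [walsh_add_one, ← mul_sum]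
    rcases Nat.even_or_odd #u with he | ho
    · have : #u ≤ 2 * k := by obtain ⟨p, hp⟩ := he; omega
      rw [hd.2 u hu he this]
      simp
    · rw [ho.neg_one_pow]
      ring
  · rw [card_union_of_disjoint hdisj, card_image_of_injective _ hinj, hcard, two_mul]

-- Twice the indicator of `x a = 0` is `1 + walsh {a} x`.
open Finset in
theorem two_mul_sum_filter_walsh {n : ℕ} (D : Finset (Fin n → ZMod 2)) (a : Fin n)
    (u : Finset (Fin n)) :
    2 * ∑ x ∈ D with x a = 0, walsh u x =
      ∑ x ∈ D, walsh u x + ∑ x ∈ D, walsh (symmDiff u {a}) x := by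
  rw [sum_filter, mul_sum, ← sum_add_distrib]
  refine sum_congr rfl fun x _ => ?_
  rw [← walsh_mul]
  by_cases h : x a = 0
  · simp [h, walsh, binarySign]; ring
  · simp [h, walsh, binarySign]

open Finset in
/-- The half of a tight `(2k+1)`-design on which a coordinate vanishes is a tight
`(k,k)`-design. -/
theorem IsTightOddDesign.filter_eq_zero {n k : ℕ} (hk : 1 ≤ k) (hn : 2 * k + 1 ≤ n) (a : Fin n)
    {D : Finset (Fin n → ZMod 2)} (hD : IsTightOddDesign k D) :
    IsTightKKDesign k (D.filter fun x => x a = 0) := by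
  obtain ⟨hd, hcard⟩ := hD
  rw [isMDesign_iff (by omega) hn] at hd
  have h0 : 2 * #(D.filter fun x => x a = 0) = #D := by
    have h := two_mul_sum_filter_walsh D a ∅
    have ha := hd.2 {a} (singleton_nonempty a) (by simp)
    rw [show symmDiff ∅ {a} = ({a} : Finset (Fin n)) from bot_symmDiff _, ha] at h
    simp only [walsh, prod_empty, sum_const, nsmul_eq_mul, mul_one, add_zero] at h
    exact_mod_cast h
  refine ⟨(isKKDesign_iff hk (by omega) _).2 ⟨card_pos.1 ?_, fun u hu he hle => ?_⟩, by omega⟩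
  · have := hd.1.card_pos
    omega
  · have h := two_mul_sum_filter_walsh D a u
    have hs := card_symmDiff_add u {a}
    rw [card_singleton] at hs
    -- An even set cannot equal `{a}`.
    have hpos : 0 < #(symmDiff u {a}) := by
      obtain ⟨p, hp⟩ := he
      omega
    rw [hd.2 u hu (by omega), hd.2 _ (card_pos.1 hpos) (by omega)] at h
    linarith

theorem theorem5p1 (n k : ℕ) (hk : 1 ≤ k) (hn : 2 * k + 1 ≤ n) :
    (∃ C : Finset (Fin n → ZMod 2), IsTightKKDesign k C) ↔
      (∃ D : Finset (Fin n → ZMod 2), IsTightOddDesign k D) :=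
  ⟨fun ⟨_, hC⟩ => ⟨_, hC.union_antipodes hk hn⟩,
    fun ⟨_, hD⟩ => ⟨_, hD.filter_eq_zero hk hn ⟨0, by omega⟩⟩⟩
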